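/- Let $\mathbb K=\mathbb R$ or $\mathbb C$, and let $r=(r_n)_{n\ge0}$, $t=(t_n)_{n\ge0}$, $s=(s_n)_{n\ge0}$ be sequences in $\mathbb K$ with $r_n\neq0$ and $t_n\ne0$ for all $n$ and $s_0\neq0$. For a sequence $x$ put $\Delta x_k=x_k-x_{k-1}$ ($x_{-1}=0$), and let $$l_\infty(r,s,t;\Delta)=\Big\{x=(x_n)_{n\ge 0}:\ \Big(\tfrac1{r_n}\sum_{k=0}^n s_{n-k}t_k\,\Delta x_k\Big)_n\in l_\infty\Big\},$$ where $l_\infty$, $c$, $c_0$ denote the spaces of bounded, convergent and null sequences in $\mathbb K$. Let $D^{(s)}_0=1/s_0$ and, for $n\ge1$, $D_n^{(s)}=s_0^{-(n+1)}\det\big(s_{i-j+1}\big)_{1\le i,j\le n}$ with $s_{i}:=0$ for $i<0$. Put $$s_{jk}=\sum_{l=0}^{j-k}(-1)^l\frac{D_l^{(s)}}{t_{l+k}}\,r_k\quad(0\le k\le j),\qquad s_{jk}=0\quad(k>j).$$ For an infinite matrix $A=(a_{nk})_{n,k\ge0}$ over $\mathbb K$ with rows $A_n$ let $$R_k(A_n)=\sum_{j=k}^\infty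 a_{nj}s_{jk},\qquad w^{A_n}_{mk}=\sum_{j=m}^\infty a_{nj}s_{jk}\ \ (0\le k\le m),\qquad w^{A_n}_{mk}=0\ \ (k>m).$$ Infinite series are limits of partial sums, and a condition below that mentions $R_k(A_n)$, $w_{mk}^{A_n}$, a limit or an infinite sum includes that the series and limits in it converge (in $\mathbb K$) for all values of the indices. For sequence spaces $U,V$, $A\in(U,V)$ means that for every $x\in U$ the series $(Ax)_n=\sum_k a_{nk}x_k$ converges for every $n$ and $Ax\in V$. Consider the conditions - (4.12) $\sup_n\sum_{k=0}^\infty|R_k(A_n)|<\infty$; - (4.16) $\lim_{n\to\infty}R_k(A_n)$ exists for all $k$; - (4.17) $\lim_{n\to\infty}\sum_{k=0}^\infty|R_k(A_n)|=0$; - (4.18) $\lim_{m\to\infty}\sum_{k=0}^m|w^{A_n}_{mk}|=0$ for all $n$; - (4.19) $\lim_{n\to\infty}\sum_{k=0}^\infty\big|R_k(A_n)-\lim_{i\to\infty}R_k(A_i)\big|=0$. Then: (a) $A\in(l_\infty(r,s,t;\Delta),c_0)$ if and only if (4.17) and (4.18) hold. (b) $A\in(l_\infty(r,s,t;\Delta),c)$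 if and only if (4.12), (4.16), (4.18) and (4.19) hold. (c) $A\in(l_\infty(r,s,t;\Delta),l_\infty)$ if and only if (4.12) and (4.18) hold. Moreover, for all $n,k$ such that $\sum_j a_{nj}$ converges and $\lim_{m\to\infty}s_{mk}\sum_{j=m+1}^\infty a_{nj}=0$, the series $\sum_{j\ge k}a_{nj}s_{jk}$ converges if and only if $\sum_{l\ge0}(-1)^l\frac{D^{(s)}_l}{t_{l+k}}\sum_{j=k+l}^\infty a_{nj}$ does, and in that case $$R_k(A_n)=r_k\Big[\frac{a_{nk}}{s_0t_k}+\Big(\frac{D^{(s)}_0}{t_k}-\frac{D^{(s)}_1}{t_{k+1}}\Big)\sum_{j=k+1}^\infty a_{nj}+\sum_{l=2}^\infty(-1)^l\frac{D^{(s)}_l}{t_{l+k}}\sum_{j=k+l}^\infty a_{nj}\Big]$$ and, for all $m\ge k$, $$w^{A_n}_{mk}=r_k\Big[\sum_{l=0}^{m-k}(-1)^l\frac{D^{(s)}_l}{t_{l+k}}\sum_{j=m}^\infty a_{nj}+\sum_{l=m-k+1}^\infty(-1)^l\frac{D^{(s)}_l}{t_{l+k}}\sum_{j=k+l}^\infty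 a_{nj}\Big].$$ -/

import Mathlib

open Filter Topology

namespace GenMeans

noncomputable section

/-! Sequences are functions `ℕ → 𝕜` with `𝕜 = ℝ` or `ℂ`. An infinite series is the limit of its
partial sums (ordinary, possibly conditional, convergence). -/

/-- The series `∑_{j ≥ 0} f j` converges. -/
def SeriesConverges {𝕜 : Type*} [RCLike 𝕜] (f : ℕ → 𝕜) : Prop :=
  ∃ l : 𝕜, Tendsto (fun N => ∑ j ∈ Finset.range N, f j) atTop (𝓝 l)

/-- The series `∑_{j ≥ m} f j` (meaningful when the series converges). -/
def seriesFrom {𝕜 : Type*} [RCLike 𝕜] (m : ℕ) (f : ℕ → 𝕜) : 𝕜 :=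
  limUnder atTop (fun N => ∑ i ∈ Finset.range N, f (m + i))

/-- Bounded sequences. -/
def linf (𝕜 : Type*) [RCLike 𝕜] : Set (ℕ → 𝕜) := {x | ∃ C : ℝ, ∀ n, ‖x n‖ ≤ C}

/-- Convergent sequences. -/
def conv (𝕜 : Type*) [RCLike 𝕜] : Set (ℕ → 𝕜) := {x | ∃ l : 𝕜, Tendsto x atTop (𝓝 l)}

/-- Null sequences. -/
def null (𝕜 : Type*) [RCLike 𝕜] : Set (ℕ → 𝕜) := {x | Tendsto x atTop (𝓝 0)}

/-- `A ∈ (U, V)`: for every `x ∈ U` all the series `(Ax)_n = ∑_k a_{nk} x_k` converge and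
`Ax ∈ V`. -/
def MapsInto {𝕜 : Type*} [RCLike 𝕜] (A : ℕ → ℕ → 𝕜) (U V : Set (ℕ → 𝕜)) : Prop :=
  ∀ x ∈ U, (∀ n, SeriesConverges (fun k => A n k * x k)) ∧
    (fun n => seriesFrom 0 (fun k => A n k * x k)) ∈ V

/-- `Δ x_k = x_k - x_{k-1}`, with `x_{-1} = 0`. -/
def backDiff {𝕜 : Type*} [RCLike 𝕜] (x : ℕ → 𝕜) (k : ℕ) : 𝕜 :=
  x k - (if k = 0 then 0 else x (k - 1))

/-- The generalized means of the difference sequence: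
`(1 / r_n) ∑_{k=0}^n s_{n-k} t_k Δ x_k`. -/
def genMeanDiff {𝕜 : Type*} [RCLike 𝕜] (r s t x : ℕ → 𝕜) (n : ℕ) : 𝕜 :=
  (1 / r n) * ∑ k ∈ Finset.range (n + 1), s (n - k) * t k * backDiff x k

/-- The space `X(r, s, t; Δ)`. -/
def genMeanSpace {𝕜 : Type*} [RCLike 𝕜] (X : Set (ℕ → 𝕜)) (r s t : ℕ → 𝕜) : Set (ℕ → 𝕜) :=
  {x | genMeanDiff r s t x ∈ X}

/-- `D_n^{(s)} = s_0^{-(n+1)} det M_n`, where `M_n` is the `n × n` matrix with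
`(i, j)` entry `s_{i-j+1}` if `j ≤ i + 1` and `0` otherwise. For `n = 0` the determinant is `1`
and `D_0^{(s)} = 1 / s_0`. -/
def D {𝕜 : Type*} [RCLike 𝕜] (s : ℕ → 𝕜) (n : ℕ) : 𝕜 :=
  (1 / s 0 ^ (n + 1)) *
    Matrix.det (Matrix.of fun i j : Fin n =>
      if (j : ℕ) ≤ (i : ℕ) + 1 then s ((i : ℕ) + 1 - (j : ℕ)) else 0)

/-- The triangle `S = (s_{jk})`, inverse to the triangle `A(r, s, t) · Δ`:
`s_{jk} = ∑_{l=0}^{j-k} (-1)^l (D_l / t_{l+k}) r_k` for `k ≤ j`, and `0` for `k > j`. -/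
def S {𝕜 : Type*} [RCLike 𝕜] (r s t : ℕ → 𝕜) (j k : ℕ) : 𝕜 :=
  if k ≤ j then ∑ l ∈ Finset.range (j - k + 1), (-1) ^ l * (D s l / t (l + k)) * r k else 0

/-- The series defining `R_k(a)` (equivalently, each series defining `w^a_{mk}`) converges. -/
def RExists {𝕜 : Type*} [RCLike 𝕜] (r s t a : ℕ → 𝕜) (k : ℕ) : Prop :=
  SeriesConverges (fun j => a j * S r s t j k)

/-- `R_k(a) = ∑_{j ≥ k} a_j s_{jk}`. -/
def R {𝕜 : Type*} [RCLike 𝕜] (r s t a : ℕ → 𝕜) (k : ℕ) : 𝕜 :=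
  seriesFrom k (fun j => a j * S r s t j k)

/-- `w^a_{mk} = ∑_{j ≥ m} a_j s_{jk}` for `k ≤ m`, and `0` for `k > m`. -/
def w {𝕜 : Type*} [RCLike 𝕜] (r s t a : ℕ → 𝕜) (m k : ℕ) : 𝕜 :=
  if k ≤ m then seriesFrom m (fun j => a j * S r s t j k) else 0

/-- All `R_k(A_n)` exist and `sup_n ∑_k |R_k(A_n)| < ∞`. -/
def SupRowSums {𝕜 : Type*} [RCLike 𝕜] (r s t : ℕ → 𝕜) (A : ℕ → ℕ → 𝕜) : Prop :=
  (∀ n k, RExists r s t (A n) k) ∧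
  (∀ n, Summable fun k => ‖R r s t (A n) k‖) ∧
  ∃ C : ℝ, ∀ n, ∑' k, ‖R r s t (A n) k‖ ≤ C

/-- All `R_k(A_n)` exist and `lim_n R_k(A_n)` exists for every `k`. -/
def ColumnLimits {𝕜 : Type*} [RCLike 𝕜] (r s t : ℕ → 𝕜) (A : ℕ → ℕ → 𝕜) : Prop :=
  (∀ n k, RExists r s t (A n) k) ∧
  ∀ k, ∃ l : 𝕜, Tendsto (fun n => R r s t (A n) k) atTop (𝓝 l)

/-- All `R_k(A_n)` exist, all the series `∑_k |R_k(A_n)|` converge, and their sums tend to `0`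
as `n → ∞`. -/
def RowSumsToZero {𝕜 : Type*} [RCLike 𝕜] (r s t : ℕ → 𝕜) (A : ℕ → ℕ → 𝕜) : Prop :=
  (∀ n k, RExists r s t (A n) k) ∧
  (∀ n, Summable fun k => ‖R r s t (A n) k‖) ∧
  Tendsto (fun n => ∑' k, ‖R r s t (A n) k‖) atTop (𝓝 0)

/-- All `w^{A_n}_{mk}` exist and `lim_m ∑_{k=0}^m |w^{A_n}_{mk}| = 0` for every `n`. -/
def TailSumsToZero {𝕜 : Type*} [RCLike 𝕜] (r s t : ℕ → 𝕜) (A : ℕ → ℕ → 𝕜) : Prop :=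
  (∀ n k, RExists r s t (A n) k) ∧
  ∀ n, Tendsto (fun m => ∑ k ∈ Finset.range (m + 1), ‖w r s t (A n) m k‖) atTop (𝓝 0)

/-- All `R_k(A_n)` exist, `ρ_k = lim_n R_k(A_n)` exists for every `k`, all the series
`∑_k |R_k(A_n) - ρ_k|` converge, and their sums tend to `0` as `n → ∞`. -/
def RowDistancesToZero {𝕜 : Type*} [RCLike 𝕜] (r s t : ℕ → 𝕜) (A : ℕ → ℕ → 𝕜) : Prop :=
  (∀ n k, RExists r s t (A n) k) ∧
  ∃ ρ : ℕ → 𝕜, (∀ k, Tendsto (fun n => R r s t (A n) k) atTop (𝓝 (ρ k))) ∧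
    (∀ n, Summable fun k => ‖R r s t (A n) k - ρ k‖) ∧
    Tendsto (fun n => ∑' k, ‖R r s t (A n) k - ρ k‖) atTop (𝓝 0)

/-- The terms `(-1)^l (D_l / t_{l+k}) ∑_{j ≥ k+l} a_j` of the outer series in the expanded forms
of `R_k(a)` and `w^a_{mk}`. -/
def expandedTerm {𝕜 : Type*} [RCLike 𝕜] (s t a : ℕ → 𝕜) (k l : ℕ) : 𝕜 :=
  (-1) ^ l * (D s l / t (l + k)) * seriesFrom (k + l) a

/-- The expanded form of `R_k(a)`:
`r_k [a_k / (s_0 t_k) + (D_0 / t_k - D_1 / t_{k+1}) ∑_{j ≥ k+1} a_j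
  + ∑_{l ≥ 2} (-1)^l (D_l / t_{l+k}) ∑_{j ≥ k+l} a_j]`. -/
def RExpanded {𝕜 : Type*} [RCLike 𝕜] (r s t a : ℕ → 𝕜) (k : ℕ) : 𝕜 :=
  r k * (a k / (s 0 * t k) + (D s 0 / t k - D s 1 / t (k + 1)) * seriesFrom (k + 1) a
    + seriesFrom 2 (expandedTerm s t a k))

/-- The expanded form of `w^a_{mk}`, for `k ≤ m`:
`r_k [∑_{l=0}^{m-k} (-1)^l (D_l / t_{l+k}) ∑_{j ≥ m} a_j
  + ∑_{l ≥ m-k+1} (-1)^l (D_l / t_{l+k}) ∑_{j ≥ k+l} a_j]`. -/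
def wExpanded {𝕜 : Type*} [RCLike 𝕜] (r s t a : ℕ → 𝕜) (m k : ℕ) : 𝕜 :=
  r k * ((∑ l ∈ Finset.range (m - k + 1), (-1) ^ l * (D s l / t (l + k))) * seriesFrom m a
    + seriesFrom (m - k + 1) (expandedTerm s t a k))

end

end GenMeans

/-! The triangle `S` inverts the map sending x to its generalized means of differences: both are
compositions of a summation, a division and a convolution, and the numbers (-1)^l D_l are the
coefficients of 1 / ∑ s_n X^n. Hence the domain is exactly {S y : y bounded}, and a partial sum
∑_{j<N} a_j (S y)_j is the pairing of y with a finitely supported row F_N, whose entries are F_N(k)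
= ∑_{j<N} a_j s_{jk}.

By Schur's theorem, F_N converges against every bounded y iff it converges in ℓ¹. Its limit must be
R(a), and since `S` is triangular the distance splits as ‖F_N - R(a)‖₁ = ∑_{k<N} |w_{Nk}| + ∑_{k≥N}
|R_k(a)|. So convergence of every series means that R(a) ∈ ℓ¹ and the sums of |w_{mk}| vanish; then
A(S y) = (R_k(A_n)) y.

What remains is the action of a matrix with ℓ¹ rows on bounded sequences. Schur's theorem applied
again, now to the rows R(A_n), settles the targets c₀ and c; a uniform boundedness argument derived
from it settles l_∞. The expanded forms are Abel summation, whose boundary term is the one assumed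
to vanish. -/

namespace GenMeans

/-! ### Schur's theorem and uniform boundedness for ℓ¹ rows -/

section Schur

variable {𝕜 : Type*} [RCLike 𝕜]

theorem summable_mul_of_bounded {g y : ℕ → 𝕜} {C : ℝ} (hg : Summable fun k => ‖g k‖)
    (hy : ∀ k, ‖y k‖ ≤ C) : Summable fun k => g k * y k := by
  refine Summable.of_norm_bounded (g := fun k => ‖g k‖ * C) (hg.mul_right C) fun k => ?_
  rw [norm_mul]
  exact mul_le_mul_of_nonneg_left (hy k) (norm_nonneg _)

theorem norm_tsum_mul_le {g y : ℕ → 𝕜} {C : ℝ} (hg : Summable fun k => ‖g k‖)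
    (hy : ∀ k, ‖y k‖ ≤ C) : ‖∑' k, g k * y k‖ ≤ (∑' k, ‖g k‖) * C := by
  rw [← tsum_mul_right]
  refine tsum_of_norm_bounded (hg.mul_right C).hasSum fun k => ?_
  rw [norm_mul]
  exact mul_le_mul_of_nonneg_left (hy k) (norm_nonneg _)

theorem exists_norm_le_one_mul_eq_norm (z : 𝕜) : ∃ u : 𝕜, ‖u‖ ≤ 1 ∧ z * u = (‖z‖ : 𝕜) := by
  by_cases hz : z = 0
  · exact ⟨0, by simp, by simp [hz]⟩
  · have h : (‖z‖ : 𝕜) ≠ 0 := by simpa using hz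
    refine ⟨(starRingEnd 𝕜) z / (‖z‖ : 𝕜), ?_, ?_⟩
    · rw [norm_div, RCLike.norm_conj, RCLike.norm_ofReal, abs_norm]
      exact div_self_le_one _
    · rw [mul_div_assoc', RCLike.mul_conj, pow_two, mul_div_assoc, div_self h, mul_one]

/-- If the functionals on bounded sequences given by absolutely summable rows converge pointwise,
then the mass of their differences outside a finite set is uniformly small. -/
theorem exists_finset_tail_le {F : ℕ → ℕ → 𝕜} (hF : ∀ n, Summable fun k => ‖F n k‖)
    (h : ∀ y ∈ linf 𝕜, ∃ l, Tendsto (fun n => ∑' k, F n k * y k) atTop (𝓝 l))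
    {ε : ℝ} (hε : 0 < ε) :
    ∃ (I : Finset ℕ) (N : ℕ), ∀ n ≥ N, ∀ m ≥ N,
      ∑' k, (if k ∈ I then 0 else ‖F n k - F m k‖) ≤ ε := by
  classical
  let X := ℕ → Metric.closedBall (0 : 𝕜) 1
  have : CompactSpace (Metric.closedBall (0 : 𝕜) 1) :=
    isCompact_iff_compactSpace.1 (isCompact_closedBall 0 1)
  have hb : ∀ (y : X) k, ‖(y k : 𝕜)‖ ≤ 1 := fun y k => mem_closedBall_zero_iff.1 (y k).2
  have hd : ∀ n m, Summable fun k => ‖F n k - F m k‖ := fun n m =>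
    Summable.of_nonneg_of_le (fun _ => norm_nonneg _) (fun k => norm_sub_le _ _)
      ((hF n).add (hF m))
  have hcont : ∀ n m, Continuous fun y : X => ∑' k, (F n k - F m k) * (y k : 𝕜) := by
    intro n m
    refine continuous_tsum (u := fun k => ‖F n k - F m k‖) (fun k => by fun_prop) (hd n m)
      fun k y => ?_
    rw [norm_mul]
    exact mul_le_of_le_one_right (norm_nonneg _) (hb y k)
  let K : ℕ → Set X := fun N =>
    ⋂ n ≥ N, ⋂ m ≥ N, {y | ‖∑' k, (F n k - F m k) * (y k : 𝕜)‖ ≤ ε / 2}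
  have hK : ∀ N, IsClosed (K N) := fun N =>
    isClosed_iInter fun n => isClosed_iInter fun _ => isClosed_iInter fun m =>
      isClosed_iInter fun _ => isClosed_le (hcont n m).norm continuous_const
  have hU : ⋃ N, K N = Set.univ := by
    refine Set.eq_univ_of_forall fun y => ?_
    obtain ⟨l, hl⟩ := h (fun k => (y k : 𝕜)) ⟨1, hb y⟩
    obtain ⟨N, hN⟩ := Metric.cauchySeq_iff.1 hl.cauchySeq (ε / 2) (by positivity)
    refine Set.mem_iUnion.2 ⟨N, ?_⟩
    simp only [K, Set.mem_iInter, Set.mem_ofPred_eq]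
    intro n hn m hm
    have := hN n hn m hm
    rw [dist_eq_norm, ← (summable_mul_of_bounded (hF n) (hb y)).tsum_sub
      (summable_mul_of_bounded (hF m) (hb y))] at this
    simpa only [sub_mul] using this.le
  -- Baire category on the product of closed unit balls, compact by Tychonoff. A basic open set in
  -- this product restricts only the finitely many coordinates in `I`.
  obtain ⟨N, y₀, hy₀⟩ := nonempty_interior_of_iUnion_of_closed hK hU
  obtain ⟨I, u, hu, hI⟩ := isOpen_pi_iff.1 isOpen_interior y₀ hy₀
  refine ⟨I, N, fun n hn m hm => ?_⟩
  have key : ∀ y : X, (∀ k ∈ I, y k = y₀ k) →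
      ‖∑' k, (F n k - F m k) * (y k : 𝕜)‖ ≤ ε / 2 := by
    intro y hy
    have hyK : y ∈ K N := interior_subset (hI fun k hk => by
      rw [hy k hk]; exact (hu k hk).2)
    simp only [K, Set.mem_iInter, Set.mem_ofPred_eq] at hyK
    exact hyK n hn m hm
  -- Off `I` the coordinates are free: `y₁` takes the aligning phases and `y₂` takes zeros.
  -- Subtracting the two pairings cancels `I` and leaves the tail mass.
  choose v hv hv' using fun k => exists_norm_le_one_mul_eq_norm (F n k - F m k)
  let y₁ : X := fun k => if k ∈ I then y₀ k else ⟨v k, by simpa using hv k⟩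
  let y₂ : X := fun k => if k ∈ I then y₀ k else ⟨0, by simp⟩
  have h₁ := key y₁ fun k hk => by simp [y₁, hk]
  have h₂ := key y₂ fun k hk => by simp [y₂, hk]
  have hs : ((∑' k, (if k ∈ I then 0 else ‖F n k - F m k‖) : ℝ) : 𝕜)
      = ∑' k, (F n k - F m k) * (y₁ k : 𝕜) - ∑' k, (F n k - F m k) * (y₂ k : 𝕜) := by
    rw [← (summable_mul_of_bounded (hd n m) (hb y₁)).tsum_sub
      (summable_mul_of_bounded (hd n m) (hb y₂)), RCLike.ofReal_tsum]
    refine tsum_congr fun k => ?_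
    by_cases hk : k ∈ I
    · simp [y₁, y₂, hk]
    · simp [y₁, y₂, hk, hv']
  calc ∑' k, (if k ∈ I then 0 else ‖F n k - F m k‖)
      ≤ ‖((∑' k, (if k ∈ I then 0 else ‖F n k - F m k‖) : ℝ) : 𝕜)‖ := by
        rw [RCLike.norm_ofReal]; exact le_abs_self _
    _ ≤ ε / 2 + ε / 2 := by rw [hs]; exact (norm_sub_le _ _).trans (add_le_add h₁ h₂)
    _ = ε := by ring

theorem single_mem_linf (k : ℕ) : (Pi.single k 1 : ℕ → 𝕜) ∈ linf 𝕜 := by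
  refine ⟨1, fun n => ?_⟩
  by_cases h : n = k
  · subst h; simp
  · simp [Pi.single_eq_of_ne h]

theorem tsum_mul_single (g : ℕ → 𝕜) (k : ℕ) :
    ∑' i, g i * (Pi.single k 1 : ℕ → 𝕜) i = g k := by
  rw [tsum_eq_single k fun i hi => by simp [Pi.single_eq_of_ne hi]]
  simp

theorem lp_one_norm_eq (f : lp (fun _ : ℕ => 𝕜) 1) : ‖f‖ = ∑' k, ‖f k‖ := by
  rw [lp.norm_eq_tsum_rpow (by norm_num)]
  simp

/-- Schur's theorem: absolutely summable rows which converge weakly against all bounded sequences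
converge in `ℓ¹`. -/
theorem schur {F : ℕ → ℕ → 𝕜} (hF : ∀ n, Summable fun k => ‖F n k‖)
    (h : ∀ y ∈ linf 𝕜, ∃ l, Tendsto (fun n => ∑' k, F n k * y k) atTop (𝓝 l)) :
    ∃ g : ℕ → 𝕜, (Summable fun k => ‖g k‖) ∧ (∀ k, Tendsto (fun n => F n k) atTop (𝓝 (g k))) ∧
      (∀ n, Summable fun k => ‖F n k - g k‖) ∧
      Tendsto (fun n => ∑' k, ‖F n k - g k‖) atTop (𝓝 0) := by
  classical
  have hd : ∀ n m, Summable fun k => ‖F n k - F m k‖ := fun n m =>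
    Summable.of_nonneg_of_le (fun _ => norm_nonneg _) (fun k => norm_sub_le _ _)
      ((hF n).add (hF m))
  let f : ℕ → lp (fun _ : ℕ => 𝕜) 1 := fun n =>
    ⟨F n, memℓp_gen (by simpa using hF n)⟩
  have hcauchy : CauchySeq f := by
    refine Metric.cauchySeq_iff.2 fun ε hε => ?_
    obtain ⟨I, N, hN⟩ := exists_finset_tail_le hF h (half_pos hε)
    have hcoord : ∀ k, CauchySeq fun n => F n k := fun k => by
      obtain ⟨l, hl⟩ := h _ (single_mem_linf k)
      simp only [tsum_mul_single] at hl
      exact hl.cauchySeq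
    have hI : ∃ M, ∀ n ≥ M, ∀ m ≥ M, ∑ k ∈ I, ‖F n k - F m k‖ < ε / 2 := by
      have ht : Tendsto (fun p : ℕ × ℕ => ∑ k ∈ I, ‖F p.1 k - F p.2 k‖) atTop (𝓝 0) := by
        rw [← Finset.sum_const_zero (s := I)]
        refine tendsto_finsetSum _ fun k _ => ?_
        simpa only [dist_eq_norm] using cauchySeq_iff_tendsto_dist_atTop_0.1 (hcoord k)
      obtain ⟨⟨a, b⟩, hab⟩ := eventually_atTop.1 (ht.eventually (gt_mem_nhds (half_pos hε)))
      exact ⟨max a b, fun n hn m hm =>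
        hab (n, m) ⟨(le_max_left _ _).trans hn, (le_max_right _ _).trans hm⟩⟩
    obtain ⟨M, hM⟩ := hI
    refine ⟨max N M, fun n hn m hm => ?_⟩
    have h₁ := hN n ((le_max_left _ _).trans hn) m ((le_max_left _ _).trans hm)
    have h₂ := hM n ((le_max_right _ _).trans hn) m ((le_max_right _ _).trans hm)
    have hs₁ : HasSum (fun k => if k ∈ I then ‖F n k - F m k‖ else 0)
        (∑ k ∈ I, ‖F n k - F m k‖) := by
      rw [← Finset.sum_congr rfl fun k (hk : k ∈ I) => if_pos hk]
      exact hasSum_sum_of_ne_finset_zero fun k hk => if_neg hk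
    have hs₂ : Summable fun k => if k ∈ I then 0 else ‖F n k - F m k‖ :=
      Summable.of_nonneg_of_le (fun k => by split_ifs <;> positivity)
        (fun k => by split_ifs <;> simp) (hd n m)
    have heq : ‖f n - f m‖ = ∑ k ∈ I, ‖F n k - F m k‖
        + ∑' k, (if k ∈ I then 0 else ‖F n k - F m k‖) := by
      rw [lp_one_norm_eq, ← hs₁.tsum_eq, ← hs₁.summable.tsum_add hs₂]
      refine tsum_congr fun k => ?_
      have : (f n - f m) k = F n k - F m k := rfl
      by_cases hk : k ∈ I <;> simp [hk, this]
    rw [dist_eq_norm, heq]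
    linarith
  obtain ⟨g, hg⟩ := cauchySeq_tendsto_of_complete hcauchy
  have hn : ∀ n, ‖f n - g‖ = ∑' k, ‖F n k - g k‖ := fun n => by
    rw [lp_one_norm_eq]; rfl
  have hgs : Summable fun k => ‖g k‖ := by
    have := (lp.memℓp g).summable (by norm_num)
    simpa using this
  refine ⟨g, hgs, fun k => ?_, fun n => ?_, ?_⟩
  · refine tendsto_iff_norm_sub_tendsto_zero.2 ?_
    refine squeeze_zero (fun _ => norm_nonneg _) (fun n => ?_)
      (tendsto_iff_norm_sub_tendsto_zero.1 hg)
    exact lp.norm_apply_le_norm (by norm_num) (f n - g) k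
  · exact Summable.of_nonneg_of_le (fun _ => norm_nonneg _) (fun k => norm_sub_le _ _)
      ((hF n).add hgs)
  · simpa only [hn] using tendsto_iff_norm_sub_tendsto_zero.1 hg

/-- Absolutely summable rows which are bounded against every bounded sequence are bounded
in `ℓ¹`. -/
theorem exists_bound_row_sums {F : ℕ → ℕ → 𝕜} (hF : ∀ n, Summable fun k => ‖F n k‖)
    (h : ∀ y ∈ linf 𝕜, (fun n => ∑' k, F n k * y k) ∈ linf 𝕜) :
    ∃ C : ℝ, ∀ n, ∑' k, ‖F n k‖ ≤ C := by
  by_contra! hcon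
  -- With norms above (j+1)², division by j+1 makes the rows tend weakly to 0 while their norms stay
  -- above j+1, against Schur's theorem.
  choose φ hφ using fun j : ℕ => hcon (((j : ℝ) + 1) * (j + 1))
  let G : ℕ → ℕ → 𝕜 := fun j k => ((j : 𝕜) + 1)⁻¹ * F (φ j) k
  have hnorm : ∀ j : ℕ, ‖((j : 𝕜) + 1)⁻¹‖ = ((j : ℝ) + 1)⁻¹ := fun j => by
    rw [norm_inv, ← Nat.cast_succ, RCLike.norm_natCast, Nat.cast_succ]
  have hG : ∀ j, Summable fun k => ‖G j k‖ := fun j => by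
    simpa only [G, norm_mul] using (hF (φ j)).mul_left _
  have hGs : ∀ j, ∑' k, ‖G j k‖ = ((j : ℝ) + 1)⁻¹ * ∑' k, ‖F (φ j) k‖ := fun j => by
    simp only [G, norm_mul, tsum_mul_left, hnorm]
  have hlim : ∀ y ∈ linf 𝕜, Tendsto (fun j => ∑' k, G j k * y k) atTop (𝓝 0) := by
    intro y hy
    obtain ⟨C, hC⟩ := h y hy
    have h0 : Tendsto (fun j : ℕ => ((j : ℝ) + 1)⁻¹ * C) atTop (𝓝 0) := by
      simpa using (tendsto_one_div_add_atTop_nhds_zero_nat (𝕜 := ℝ)).mul_const C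
    refine squeeze_zero_norm (fun j => ?_) h0
    simp only [G, mul_assoc, tsum_mul_left, norm_mul, hnorm]
    exact mul_le_mul_of_nonneg_left (hC (φ j)) (by positivity)
  obtain ⟨g, -, hg₁, -, hg₂⟩ := schur hG fun y hy => ⟨0, hlim y hy⟩
  have hg0 : ∀ k, g k = 0 := fun k => by
    have := hlim _ (single_mem_linf k)
    simp only [tsum_mul_single] at this
    exact tendsto_nhds_unique (hg₁ k) this
  simp only [hg0, sub_zero] at hg₂
  obtain ⟨j, hj⟩ := (hg₂.eventually (gt_mem_nhds one_pos)).exists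
  have h₁ := hφ j
  rw [hGs, inv_mul_lt_iff₀ (by positivity)] at hj
  nlinarith [Nat.cast_nonneg (α := ℝ) j]

end Schur

/-! ### Reciprocal power series and inversion of the generalized means -/

section Inverse

variable {𝕜 : Type*} [RCLike 𝕜]

theorem seriesFrom_eq {f : ℕ → 𝕜} {m : ℕ} {l : 𝕜}
    (h : Tendsto (fun N => ∑ i ∈ Finset.range N, f (m + i)) atTop (𝓝 l)) :
    seriesFrom m f = l := h.limUnder_eq

theorem tendsto_shifted_sum {f : ℕ → 𝕜} {l : 𝕜}
    (h : Tendsto (fun N => ∑ j ∈ Finset.range N, f j) atTop (𝓝 l)) (m : ℕ) :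
    Tendsto (fun N => ∑ i ∈ Finset.range N, f (m + i)) atTop
      (𝓝 (l - ∑ j ∈ Finset.range m, f j)) := by
  have h' := (h.comp (tendsto_add_atTop_nat m)).sub_const (∑ j ∈ Finset.range m, f j)
  refine h'.congr fun N => ?_
  simp only [Function.comp_apply]
  rw [add_comm N m, Finset.sum_range_add, add_sub_cancel_left]

theorem seriesFrom_eq_sub {f : ℕ → 𝕜} {l : 𝕜}
    (h : Tendsto (fun N => ∑ j ∈ Finset.range N, f j) atTop (𝓝 l)) (m : ℕ) :
    seriesFrom m f = l - ∑ j ∈ Finset.range m, f j :=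
  seriesFrom_eq (tendsto_shifted_sum h m)

theorem tendsto_seriesFrom {f : ℕ → 𝕜} (h : SeriesConverges f) :
    Tendsto (fun N => ∑ j ∈ Finset.range N, f j) atTop (𝓝 (seriesFrom 0 f)) := by
  obtain ⟨l, hl⟩ := h
  rwa [seriesFrom_eq_sub hl 0, Finset.sum_range_zero, sub_zero]

theorem seriesFrom_eq_zero_sub {f : ℕ → 𝕜} (h : SeriesConverges f) (m : ℕ) :
    seriesFrom m f = seriesFrom 0 f - ∑ j ∈ Finset.range m, f j :=
  seriesFrom_eq_sub (tendsto_seriesFrom h) m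

theorem seriesFrom_succ {f : ℕ → 𝕜} (h : SeriesConverges f) (m : ℕ) :
    seriesFrom m f = f m + seriesFrom (m + 1) f := by
  rw [seriesFrom_eq_zero_sub h m, seriesFrom_eq_zero_sub h (m + 1), Finset.sum_range_succ]
  ring

/-- The numbers `(-1)^n D_n` are the coefficients of the reciprocal of `∑ s_n X^n`. -/
theorem neg_one_pow_mul_D {s : ℕ → 𝕜} (hs : s 0 ≠ 0) (n : ℕ) :
    (-1) ^ n * D s n = PowerSeries.coeff n (PowerSeries.mk s)⁻¹ := by
  set c : ℕ → 𝕜 := fun n => PowerSeries.coeff n (PowerSeries.mk s)⁻¹ with hc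
  have hmul : PowerSeries.mk s * PowerSeries.mk c = 1 := by
    have : PowerSeries.mk c = (PowerSeries.mk s)⁻¹ := by ext; simp [hc]
    rw [this]
    exact PowerSeries.mul_inv_cancel _ (by simpa using hs)
  have hconv : ∀ i : ℕ, ∑ j ∈ Finset.range (i + 1), s (i - j) * c j = if i = 0 then 1 else 0 := by
    intro i
    have := congrArg (PowerSeries.coeff i) hmul
    rw [mul_comm, PowerSeries.coeff_mul, PowerSeries.coeff_one,
      Finset.Nat.sum_antidiagonal_eq_sum_range_succ_mk] at this
    rw [← this]
    exact Finset.sum_congr rfl fun j _ => by simp [mul_comm]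
  -- Cramer's rule for the Toeplitz system L c = e₀: deleting row 0 and the last column of `L`
  -- leaves the matrix defining `D s n`, with cofactor sign (-1)^n.
  let L : Matrix (Fin (n + 1)) (Fin (n + 1)) 𝕜 :=
    Matrix.of fun i j => if (j : ℕ) ≤ (i : ℕ) then s ((i : ℕ) - (j : ℕ)) else 0
  have hLdet : L.det = s 0 ^ (n + 1) := by
    rw [Matrix.det_of_isLowerTriangular]
    · simp [L]
    · intro i j hij
      have : ¬ (j : ℕ) ≤ (i : ℕ) := not_le.2 hij
      simp only [L, Matrix.of_apply, if_neg this]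
  have hLc : L.mulVec (fun j : Fin (n + 1) => c j) = Pi.single 0 1 := by
    ext i
    have hi := hconv i
    have h1 : L.mulVec (fun j : Fin (n + 1) => c j) i
        = ∑ j ∈ Finset.range (n + 1), if j ≤ (i : ℕ) then s ((i : ℕ) - j) * c j else 0 := by
      rw [Finset.sum_range, Matrix.mulVec, dotProduct]
      refine Finset.sum_congr rfl fun j _ => ?_
      by_cases h : (j : ℕ) ≤ (i : ℕ) <;> simp only [L, Matrix.of_apply, h, if_true, if_false, zero_mul]
    rw [h1, ← Finset.sum_filter]
    have h2 : (Finset.range (n + 1)).filter (fun j => j ≤ (i : ℕ))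
        = Finset.range ((i : ℕ) + 1) := by
      ext j
      have := i.2
      simp only [Finset.mem_filter, Finset.mem_range]
      omega
    rw [h2, hi]
    by_cases h : i = 0
    · subst h; simp
    · have : (i : ℕ) ≠ 0 := fun h' => h (Fin.ext h')
      simp [h, this]
  have hadj : L.det * c n = L.adjugate (Fin.last n) 0 := by
    have h1 := congrArg (fun v => L.adjugate.mulVec v (Fin.last n)) hLc
    simp only [Matrix.mulVec_mulVec, Matrix.adjugate_mul, Matrix.smul_mulVec, Matrix.one_mulVec,
      Pi.smul_apply, smul_eq_mul, Fin.val_last, Matrix.mulVec_single_one] at h1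
    exact h1
  rw [Matrix.adjugate_fin_succ_eq_det_submatrix] at hadj
  have hsub : L.submatrix (Fin.succAbove 0) (Fin.succAbove (Fin.last n))
      = Matrix.of fun i j : Fin n =>
        if (j : ℕ) ≤ (i : ℕ) + 1 then s ((i : ℕ) + 1 - (j : ℕ)) else 0 := by
    ext i j
    simp only [L, Matrix.submatrix_apply, Matrix.of_apply, Fin.succAbove_zero, Fin.succAbove_last,
      Fin.val_succ, Fin.val_castSucc]
  rw [hsub, hLdet] at hadj
  have hs' : s 0 ^ (n + 1) ≠ 0 := pow_ne_zero _ hs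
  unfold D
  change _ = c n
  rw [← mul_right_inj' hs', hadj]
  simp only [Fin.val_zero, Fin.val_last, zero_add]
  field_simp

theorem S_self_add (r s t : ℕ → 𝕜) (k n : ℕ) :
    S r s t (k + n) k
      = r k * ∑ l ∈ Finset.range (n + 1), (-1) ^ l * (D s l / t (l + k)) := by
  rw [S, if_pos (Nat.le_add_right _ _), Nat.add_sub_cancel_left, Finset.mul_sum]
  exact Finset.sum_congr rfl fun l _ => by ring

theorem S_eq_zero_of_lt (r s t : ℕ → 𝕜) {j k : ℕ} (h : j < k) : S r s t j k = 0 := by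
  rw [S, if_neg (not_le.2 h)]

/-- The transform of a sequence by the triangle `S`. -/
def applyS (r s t y : ℕ → 𝕜) (j : ℕ) : 𝕜 :=
  ∑ k ∈ Finset.range (j + 1), S r s t j k * y k

theorem backDiff_injective : Function.Injective (backDiff (𝕜 := 𝕜)) := by
  intro x x' h
  funext n
  induction n with
  | zero => simpa [backDiff] using congrFun h 0
  | succ n ih => simpa [backDiff, ih] using congrFun h (n + 1)

/-- Consecutive entries s_{jk} and s_{j-1,k} differ only by the term l = j - k, whose denominator is
t_j. Multiplying by t_j leaves a convolution. -/
theorem mul_backDiff_applyS {s t : ℕ → 𝕜} (r y : ℕ → 𝕜) (ht : ∀ n, t n ≠ 0) (hs : s 0 ≠ 0)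
    (j : ℕ) :
    t j * backDiff (applyS r s t y) j =
      PowerSeries.coeff j ((PowerSeries.mk s)⁻¹ * PowerSeries.mk fun n => r n * y n) := by
  have hx : backDiff (applyS r s t y) j = ∑ k ∈ Finset.range (j + 1),
      (-1) ^ (j - k) * (D s (j - k) / t j) * r k * y k := by
    have hdiff : backDiff (applyS r s t y) j = ∑ k ∈ Finset.range (j + 1),
        (S r s t j k - if j = 0 then 0 else S r s t (j - 1) k) * y k := by
      simp only [sub_mul, Finset.sum_sub_distrib]
      unfold backDiff
      congr 1
      rcases j with _ | j
      · simp
      · simp only [Nat.succ_ne_zero, if_false, Nat.succ_sub_one]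
        rw [Finset.sum_range_succ, S_eq_zero_of_lt _ _ _ (Nat.lt_succ_self j), zero_mul, add_zero]
        rfl
    rw [hdiff]
    refine Finset.sum_congr rfl fun k hk => ?_
    congr 1
    obtain ⟨n, rfl⟩ := Nat.exists_eq_add_of_le (Nat.lt_succ_iff.1 (Finset.mem_range.1 hk))
    rw [S_self_add, Nat.add_sub_cancel_left]
    rcases n with _ | n
    · have : (if k + 0 = 0 then 0 else S r s t (k + 0 - 1) k) = 0 := by
        split_ifs with h
        · rfl
        · exact S_eq_zero_of_lt _ _ _ (by omega)
      rw [this]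
      simp
      ring
    · rw [if_neg (by omega), show k + (n + 1) - 1 = k + n from rfl, S_self_add,
        Finset.sum_range_succ _ (n + 1), add_comm k (n + 1)]
      ring
  rw [hx, mul_comm (PowerSeries.mk s)⁻¹, PowerSeries.coeff_mul,
    Finset.Nat.sum_antidiagonal_eq_sum_range_succ_mk, Finset.mul_sum]
  refine Finset.sum_congr rfl fun k _ => ?_
  have := ht j
  simp only [PowerSeries.coeff_mk, ← neg_one_pow_mul_D hs]
  field_simp

theorem sum_mul_backDiff_eq_coeff (s t x : ℕ → 𝕜) (n : ℕ) :
    ∑ k ∈ Finset.range (n + 1), s (n - k) * t k * backDiff x k =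
      PowerSeries.coeff n (PowerSeries.mk s * PowerSeries.mk fun k => t k * backDiff x k) := by
  rw [mul_comm, PowerSeries.coeff_mul, Finset.Nat.sum_antidiagonal_eq_sum_range_succ_mk]
  exact Finset.sum_congr rfl fun k _ => by simp; ring

theorem genMeanDiff_applyS {r s t : ℕ → 𝕜} (hr : ∀ n, r n ≠ 0) (ht : ∀ n, t n ≠ 0)
    (hs : s 0 ≠ 0) (y : ℕ → 𝕜) : genMeanDiff r s t (applyS r s t y) = y := by
  funext n
  have h : (PowerSeries.mk fun k => t k * backDiff (applyS r s t y) k)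
      = (PowerSeries.mk s)⁻¹ * PowerSeries.mk fun n => r n * y n := by
    ext j
    rw [PowerSeries.coeff_mk, mul_backDiff_applyS r y ht hs]
  rw [genMeanDiff, sum_mul_backDiff_eq_coeff, h, ← mul_assoc,
    PowerSeries.mul_inv_cancel _ (by simpa using hs), one_mul, PowerSeries.coeff_mk]
  have := hr n
  field_simp

theorem applyS_genMeanDiff {r s t : ℕ → 𝕜} (hr : ∀ n, r n ≠ 0) (ht : ∀ n, t n ≠ 0)
    (hs : s 0 ≠ 0) (x : ℕ → 𝕜) : applyS r s t (genMeanDiff r s t x) = x := by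
  refine backDiff_injective (funext fun j => mul_left_cancel₀ (ht j) ?_)
  have h : (PowerSeries.mk fun n => r n * genMeanDiff r s t x n)
      = PowerSeries.mk s * PowerSeries.mk fun k => t k * backDiff x k := by
    ext n
    rw [PowerSeries.coeff_mk, genMeanDiff, sum_mul_backDiff_eq_coeff]
    have := hr n
    field_simp
  rw [mul_backDiff_applyS r _ ht hs, h, ← mul_assoc,
    PowerSeries.inv_mul_cancel _ (by simpa using hs), one_mul, PowerSeries.coeff_mk]

theorem sum_mul_applyS (r s t a y : ℕ → 𝕜) (N : ℕ) :
    ∑ j ∈ Finset.range N, a j * applyS r s t y j =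
      ∑ k ∈ Finset.range N, (∑ j ∈ Finset.range N, a j * S r s t j k) * y k := by
  simp only [Finset.sum_mul]
  rw [Finset.sum_comm]
  refine Finset.sum_congr rfl fun j hj => ?_
  rw [applyS, Finset.mul_sum]
  simp only [mul_assoc]
  refine Finset.sum_subset (Finset.range_subset_range.2 (Finset.mem_range.1 hj)) fun k _ hk => ?_
  rw [S_eq_zero_of_lt _ _ _ (by simpa using hk)]
  simp

end Inverse

/-! ### Abel summation and the expanded forms -/

section Expanded

variable {𝕜 : Type*} [RCLike 𝕜]

/-- Abel summation, with a_j written as a difference of consecutive tails of ∑ a_j. -/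
theorem sum_mul_S_eq (r s t : ℕ → 𝕜) {a : ℕ → 𝕜} (ha : SeriesConverges a) (k n : ℕ) :
    ∑ j ∈ Finset.range (k + n), a j * S r s t j k =
      r k * (∑ l ∈ Finset.range n, expandedTerm s t a k l
        - (∑ l ∈ Finset.range n, (-1) ^ l * (D s l / t (l + k))) * seriesFrom (k + n) a) := by
  induction n with
  | zero =>
    simp only [Finset.range_zero, Finset.sum_empty, zero_mul, sub_zero, mul_zero, add_zero]
    exact Finset.sum_eq_zero fun j hj => by
      rw [S_eq_zero_of_lt _ _ _ (Finset.mem_range.1 hj), mul_zero]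
  | succ n ih =>
    rw [← add_assoc, Finset.sum_range_succ, ih, S_self_add, Finset.sum_range_succ,
      Finset.sum_range_succ, expandedTerm, seriesFrom_succ ha (k + n)]
    ring

theorem tendsto_sum_mul_S_iff (r s t : ℕ → 𝕜) {a : ℕ → 𝕜} (ha : SeriesConverges a) (k : ℕ)
    (h : Tendsto (fun m => S r s t m k * seriesFrom (m + 1) a) atTop (𝓝 0)) (l : 𝕜) :
    Tendsto (fun N => ∑ j ∈ Finset.range N, a j * S r s t j k) atTop (𝓝 l) ↔
      Tendsto (fun N => r k * ∑ i ∈ Finset.range N, expandedTerm s t a k i) atTop (𝓝 l) := by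
  have hk : Tendsto (fun n => S r s t (k + n) k * seriesFrom (k + n + 1) a) atTop (𝓝 0) := by
    simpa only [add_comm k, Function.comp_def] using h.comp (tendsto_add_atTop_nat k)
  have heq : ∀ n, r k * ∑ i ∈ Finset.range (n + 1), expandedTerm s t a k i
      = ∑ j ∈ Finset.range (n + (k + 1)), a j * S r s t j k
        + S r s t (k + n) k * seriesFrom (k + n + 1) a := fun n => by
    rw [show n + (k + 1) = k + (n + 1) by ring, sum_mul_S_eq r s t ha, S_self_add, add_assoc k]
    ring
  rw [← tendsto_add_atTop_iff_nat (k + 1),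
    ← tendsto_add_atTop_iff_nat (f := fun N => r k * ∑ i ∈ Finset.range N, _) 1]
  constructor
  · intro h'
    simpa only [heq, add_zero] using h'.add hk
  · intro h'
    simpa only [heq, add_sub_cancel_right, sub_zero] using h'.sub hk

theorem expanded_forms {r s t a : ℕ → 𝕜} (hr : ∀ n, r n ≠ 0) {k : ℕ}
    (ha : SeriesConverges a)
    (h : Tendsto (fun m => S r s t m k * seriesFrom (m + 1) a) atTop (𝓝 0)) :
    (RExists r s t a k ↔ SeriesConverges (expandedTerm s t a k)) ∧
      (RExists r s t a k → R r s t a k = RExpanded r s t a k ∧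
        ∀ m, k ≤ m → w r s t a m k = wExpanded r s t a m k) := by
  have hiff : RExists r s t a k ↔ SeriesConverges (expandedTerm s t a k) := by
    constructor
    · rintro ⟨l, hl⟩
      refine ⟨(r k)⁻¹ * l, ?_⟩
      simpa only [inv_mul_cancel_left₀ (hr k)] using
        ((tendsto_sum_mul_S_iff r s t ha k h l).1 hl).const_mul (r k)⁻¹
    · rintro ⟨l, hl⟩
      exact ⟨r k * l, (tendsto_sum_mul_S_iff r s t ha k h _).2 (hl.const_mul _)⟩
  refine ⟨hiff, fun hR => ?_⟩
  have hE := hiff.1 hR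
  have htot : seriesFrom 0 (fun j => a j * S r s t j k)
      = r k * seriesFrom 0 (expandedTerm s t a k) :=
    tendsto_nhds_unique (tendsto_seriesFrom hR)
      ((tendsto_sum_mul_S_iff r s t ha k h _).2 ((tendsto_seriesFrom hE).const_mul _))
  have hw : ∀ m, k ≤ m → seriesFrom m (fun j => a j * S r s t j k) = wExpanded r s t a m k := by
    intro m hm
    obtain ⟨n, rfl⟩ := Nat.exists_eq_add_of_le hm
    rw [seriesFrom_eq_zero_sub hR, htot, sum_mul_S_eq r s t ha, wExpanded,
      Nat.add_sub_cancel_left, seriesFrom_eq_zero_sub hE (n + 1), Finset.sum_range_succ,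
      Finset.sum_range_succ, expandedTerm]
    ring
  refine ⟨?_, fun m hm => by rw [w, if_pos hm, hw m hm]⟩
  -- R_k is the case m = k of w_{mk}; it remains to split off the term l = 1 and to detach a_k from
  -- the tail starting at k.
  rw [R, hw k le_rfl, wExpanded, RExpanded, Nat.sub_self, zero_add, Finset.sum_range_one,
    seriesFrom_succ hE 1, seriesFrom_succ ha k, expandedTerm]
  have hD : D s 0 = 1 / s 0 := by simp [D]
  rw [pow_zero, pow_one, zero_add, add_comm 1 k, hD, div_div]
  ring

end Expanded

/-! ### Convergence of a single row and reduction to bounded sequences -/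

section Rows

variable {𝕜 : Type*} [RCLike 𝕜]

theorem sum_mul_S_eq_zero (r s t a : ℕ → 𝕜) {N k : ℕ} (h : N ≤ k) :
    ∑ j ∈ Finset.range N, a j * S r s t j k = 0 :=
  Finset.sum_eq_zero fun j hj => by
    rw [S_eq_zero_of_lt _ _ _ ((Finset.mem_range.1 hj).trans_le h), mul_zero]

theorem tendsto_sum_mul_S {r s t a : ℕ → 𝕜} {k : ℕ} (h : RExists r s t a k) :
    Tendsto (fun N => ∑ j ∈ Finset.range N, a j * S r s t j k) atTop (𝓝 (R r s t a k)) := by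
  rw [R, seriesFrom_eq_zero_sub h, sum_mul_S_eq_zero r s t a le_rfl, sub_zero]
  exact tendsto_seriesFrom h

theorem w_eq_R_sub {r s t a : ℕ → 𝕜} {m k : ℕ} (h : RExists r s t a k) (hk : k ≤ m) :
    w r s t a m k = R r s t a k - ∑ j ∈ Finset.range m, a j * S r s t j k := by
  rw [w, if_pos hk, seriesFrom_eq_sub (tendsto_sum_mul_S h)]

/-- For k < N the difference is -w_{Nk}; for k ≥ N triangularity kills the partial sum, leaving
-R_k. This links ℓ¹ convergence to the tail condition. -/
theorem tsum_norm_partial_sub_R {r s t a : ℕ → 𝕜} (hR : ∀ k, RExists r s t a k) {N : ℕ}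
    (hs : Summable fun k => ‖∑ j ∈ Finset.range N, a j * S r s t j k - R r s t a k‖) :
    ∑' k, ‖∑ j ∈ Finset.range N, a j * S r s t j k - R r s t a k‖
      = ∑ k ∈ Finset.range N, ‖w r s t a N k‖ + ∑' k, ‖R r s t a (k + N)‖ := by
  rw [← hs.sum_add_tsum_nat_add N]
  congr 1
  · refine Finset.sum_congr rfl fun k hk => ?_
    rw [w_eq_R_sub (hR k) (Finset.mem_range.1 hk).le, norm_sub_rev]
  · refine tsum_congr fun k => ?_
    rw [sum_mul_S_eq_zero r s t a (Nat.le_add_left N k), zero_sub, norm_neg]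

theorem summable_norm_partial (r s t a : ℕ → 𝕜) (N : ℕ) :
    Summable fun k => ‖∑ j ∈ Finset.range N, a j * S r s t j k‖ :=
  summable_of_ne_finset_zero (s := Finset.range N) fun k hk => by
    rw [sum_mul_S_eq_zero r s t a (by simpa using hk), norm_zero]

theorem tsum_partial_mul (r s t a y : ℕ → 𝕜) (N : ℕ) :
    ∑' k, (∑ j ∈ Finset.range N, a j * S r s t j k) * y k
      = ∑ j ∈ Finset.range N, a j * applyS r s t y j := by
  rw [sum_mul_applyS]
  exact tsum_eq_sum fun k hk => by
    rw [sum_mul_S_eq_zero r s t a (by simpa using hk), zero_mul]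

theorem sum_norm_w_succ {r s t a : ℕ → 𝕜} (hR : ∀ k, RExists r s t a k) (m : ℕ) :
    ∑ k ∈ Finset.range (m + 1), ‖w r s t a m k‖
      = ∑ k ∈ Finset.range m, ‖w r s t a m k‖ + ‖R r s t a m‖ := by
  rw [Finset.sum_range_succ, w_eq_R_sub (hR m) le_rfl, sum_mul_S_eq_zero r s t a le_rfl, sub_zero]

theorem tendsto_sum_mul_applyS {r s t a : ℕ → 𝕜} (hR : ∀ k, RExists r s t a k)
    (hs : Summable fun k => ‖R r s t a k‖)
    (hw : Tendsto (fun m => ∑ k ∈ Finset.range (m + 1), ‖w r s t a m k‖) atTop (𝓝 0))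
    {y : ℕ → 𝕜} (hy : y ∈ linf 𝕜) :
    Tendsto (fun N => ∑ j ∈ Finset.range N, a j * applyS r s t y j) atTop
      (𝓝 (∑' k, R r s t a k * y k)) := by
  obtain ⟨C, hC⟩ := hy
  have hd : ∀ N, Summable fun k => ‖∑ j ∈ Finset.range N, a j * S r s t j k - R r s t a k‖ :=
    fun N => Summable.of_nonneg_of_le (fun _ => norm_nonneg _) (fun _ => norm_sub_le _ _)
      ((summable_norm_partial r s t a N).add hs)
  have hw' : Tendsto (fun m => ∑ k ∈ Finset.range m, ‖w r s t a m k‖) atTop (𝓝 0) := by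
    refine squeeze_zero (fun m => Finset.sum_nonneg fun _ _ => norm_nonneg _) (fun m => ?_) hw
    rw [sum_norm_w_succ hR]
    exact le_add_of_nonneg_right (norm_nonneg _)
  have hlim : Tendsto (fun N =>
      (∑' k, ‖∑ j ∈ Finset.range N, a j * S r s t j k - R r s t a k‖) * C) atTop (𝓝 0) := by
    simp only [fun N => tsum_norm_partial_sub_R hR (hd N)]
    simpa using (hw'.add (tendsto_sum_nat_add fun k => ‖R r s t a k‖)).mul_const C
  refine tendsto_iff_norm_sub_tendsto_zero.2 (squeeze_zero (fun _ => norm_nonneg _) (fun N => ?_)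
    hlim)
  rw [← tsum_partial_mul, ← (summable_mul_of_bounded (summable_norm_partial r s t a N) hC).tsum_sub
    (summable_mul_of_bounded hs hC)]
  simpa only [sub_mul] using norm_tsum_mul_le (hd N) hC

theorem row_conditions_of_seriesConverges {r s t a : ℕ → 𝕜}
    (h : ∀ y ∈ linf 𝕜, SeriesConverges fun j => a j * applyS r s t y j) :
    (∀ k, RExists r s t a k) ∧ (Summable fun k => ‖R r s t a k‖) ∧
      Tendsto (fun m => ∑ k ∈ Finset.range (m + 1), ‖w r s t a m k‖) atTop (𝓝 0) := by
  obtain ⟨g, hg, hlim, hsum, hto⟩ := schur (summable_norm_partial r s t a) fun y hy => by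
    simp only [tsum_partial_mul]
    exact h y hy
  have hR : ∀ k, RExists r s t a k := fun k => ⟨g k, hlim k⟩
  obtain rfl : g = R r s t a :=
    funext fun k => tendsto_nhds_unique (hlim k) (tendsto_sum_mul_S (hR k))
  refine ⟨hR, hg, ?_⟩
  -- The tail condition also counts the diagonal entry w_{mm} = R_m, absent from the ℓ¹ distance.
  have hR0 : Tendsto (fun m => ‖R r s t a m‖) atTop (𝓝 0) := hg.tendsto_atTop_zero
  refine squeeze_zero (fun m => Finset.sum_nonneg fun _ _ => norm_nonneg _) (fun m => ?_)
    (by simpa using hto.add hR0)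
  rw [sum_norm_w_succ hR, tsum_norm_partial_sub_R hR (hsum m)]
  exact add_le_add_left (le_add_of_nonneg_right (tsum_nonneg fun _ => norm_nonneg _)) _

/-- Matrix maps from `l_∞(r, s, t; Δ)` are described by the matrix `(R_k(A_n))` acting on bounded
sequences. -/
theorem mapsInto_iff {r s t : ℕ → 𝕜} (hr : ∀ n, r n ≠ 0) (ht : ∀ n, t n ≠ 0) (hs : s 0 ≠ 0)
    (A : ℕ → ℕ → 𝕜) (V : Set (ℕ → 𝕜)) :
    MapsInto A (genMeanSpace (linf 𝕜) r s t) V ↔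
      (∀ n, Summable fun k => ‖R r s t (A n) k‖) ∧ TailSumsToZero r s t A ∧
        ∀ y ∈ linf 𝕜, (fun n => ∑' k, R r s t (A n) k * y k) ∈ V := by
  have heq : (∀ n, Summable fun k => ‖R r s t (A n) k‖) → TailSumsToZero r s t A →
      ∀ y ∈ linf 𝕜, (fun n => seriesFrom 0 fun j => A n j * applyS r s t y j)
        = fun n => ∑' k, R r s t (A n) k * y k := fun h₁ h₂ y hy => funext fun n =>
    seriesFrom_eq (by
      simpa only [zero_add] using tendsto_sum_mul_applyS (h₂.1 n) (h₁ n) (h₂.2 n) hy)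
  constructor
  · intro h
    have hm : ∀ y ∈ linf 𝕜, applyS r s t y ∈ genMeanSpace (linf 𝕜) r s t := fun y hy => by
      rwa [genMeanSpace, Set.mem_ofPred_eq, genMeanDiff_applyS hr ht hs]
    have hrow := fun n => row_conditions_of_seriesConverges (r := r) (s := s) (t := t) (a := A n)
      fun y hy => (h _ (hm y hy)).1 n
    have h₁ := fun n => (hrow n).2.1
    have h₂ : TailSumsToZero r s t A := ⟨fun n => (hrow n).1, fun n => (hrow n).2.2⟩
    refine ⟨h₁, h₂, fun y hy => ?_⟩
    rw [← heq h₁ h₂ y hy]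
    exact (h _ (hm y hy)).2
  · rintro ⟨h₁, h₂, h₃⟩ x hx
    rw [← applyS_genMeanDiff hr ht hs x]
    refine ⟨fun n => ⟨_, tendsto_sum_mul_applyS (h₂.1 n) (h₁ n) (h₂.2 n) hx⟩, ?_⟩
    rw [heq h₁ h₂ _ hx]
    exact h₃ _ hx

end Rows

end GenMeans

open GenMeans in
theorem corollary4p1 {𝕜 : Type*} [RCLike 𝕜] (r s t : ℕ → 𝕜)
    (hr : ∀ n, r n ≠ 0) (ht : ∀ n, t n ≠ 0) (hs : s 0 ≠ 0) (A : ℕ → ℕ → 𝕜) :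
    (GenMeans.MapsInto A (GenMeans.genMeanSpace (GenMeans.linf 𝕜) r s t) (GenMeans.null 𝕜) ↔
      GenMeans.RowSumsToZero r s t A ∧ GenMeans.TailSumsToZero r s t A) ∧
    (GenMeans.MapsInto A (GenMeans.genMeanSpace (GenMeans.linf 𝕜) r s t) (GenMeans.conv 𝕜) ↔
      GenMeans.SupRowSums r s t A ∧ GenMeans.ColumnLimits r s t A ∧
        GenMeans.TailSumsToZero r s t A ∧ GenMeans.RowDistancesToZero r s t A) ∧
    (GenMeans.MapsInto A (GenMeans.genMeanSpace (GenMeans.linf 𝕜) r s t) (GenMeans.linf 𝕜) ↔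
      GenMeans.SupRowSums r s t A ∧ GenMeans.TailSumsToZero r s t A) ∧
    -- the expanded forms of the quantities `R_k(A_n)` and `w^{A_n}_{mk}`
    (∀ n k, GenMeans.SeriesConverges (A n) →
      Filter.Tendsto (fun m => GenMeans.S r s t m k * GenMeans.seriesFrom (m + 1) (A n))
        Filter.atTop (nhds 0) →
      (GenMeans.RExists r s t (A n) k ↔
        GenMeans.SeriesConverges (GenMeans.expandedTerm s t (A n) k)) ∧
      (GenMeans.RExists r s t (A n) k →
        GenMeans.R r s t (A n) k = GenMeans.RExpanded r s t (A n) k ∧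
        ∀ m, k ≤ m → GenMeans.w r s t (A n) m k = GenMeans.wExpanded r s t (A n) m k)) := by
  refine ⟨?_, ?_, ?_, fun n k ha h => expanded_forms hr ha h⟩
  · rw [mapsInto_iff hr ht hs]
    constructor
    · rintro ⟨h₁, h₂, h₃⟩
      -- Testing on unit vectors shows that the ℓ¹ limit is 0.
      obtain ⟨g, -, hg, -, hto⟩ := schur h₁ fun y hy => ⟨0, h₃ y hy⟩
      have hg0 : ∀ k, g k = 0 := fun k => by
        have := h₃ _ (single_mem_linf k)
        simp only [tsum_mul_single] at this
        exact tendsto_nhds_unique (hg k) this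
      simp only [hg0, sub_zero] at hto
      exact ⟨⟨h₂.1, h₁, hto⟩, h₂⟩
    · rintro ⟨⟨-, h₁, hto⟩, h₂⟩
      refine ⟨h₁, h₂, fun y ⟨C, hC⟩ => ?_⟩
      exact squeeze_zero_norm (fun n => norm_tsum_mul_le (h₁ n) hC)
        (by simpa using hto.mul_const C)
  · rw [mapsInto_iff hr ht hs]
    constructor
    · rintro ⟨h₁, h₂, h₃⟩
      obtain ⟨g, -, hg, hd, hto⟩ := schur h₁ h₃
      refine ⟨⟨h₂.1, h₁, exists_bound_row_sums h₁ fun y hy => ?_⟩, ⟨h₂.1, fun k => ⟨g k, hg k⟩⟩,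
        h₂, ⟨h₂.1, g, hg, hd, hto⟩⟩
      obtain ⟨l, hl⟩ := h₃ y hy
      obtain ⟨C, hC⟩ := isBounded_iff_forall_norm_le.1 (Metric.isBounded_range_of_tendsto _ hl)
      exact ⟨C, fun n => hC _ ⟨n, rfl⟩⟩
    · rintro ⟨⟨-, h₁, -⟩, -, h₂, -, g, -, hd, hto⟩
      refine ⟨h₁, h₂, fun y ⟨C, hC⟩ => ⟨∑' k, g k * y k, ?_⟩⟩
      -- The column limits are absolutely summable because row 0 and its distance to them are.
      have hg : Summable fun k => ‖g k‖ := by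
        refine Summable.of_nonneg_of_le (fun _ => norm_nonneg _) (fun k => ?_) ((h₁ 0).add (hd 0))
        simpa using norm_sub_le (R r s t (A 0) k) (R r s t (A 0) k - g k)
      refine tendsto_iff_norm_sub_tendsto_zero.2 (squeeze_zero (fun _ => norm_nonneg _)
        (fun n => ?_) (by simpa using hto.mul_const C))
      rw [← (summable_mul_of_bounded (h₁ n) hC).tsum_sub (summable_mul_of_bounded hg hC)]
      simpa only [sub_mul] using norm_tsum_mul_le (hd n) hC
  · rw [mapsInto_iff hr ht hs]
    constructor
    · rintro ⟨h₁, h₂, h₃⟩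
      exact ⟨⟨h₂.1, h₁, exists_bound_row_sums h₁ h₃⟩, h₂⟩
    · rintro ⟨⟨-, h₁, C, hC⟩, h₂⟩
      refine ⟨h₁, h₂, fun y ⟨B, hB⟩ => ⟨C * B, fun n => ?_⟩⟩
      exact (norm_tsum_mul_le (h₁ n) hB).trans
        (mul_le_mul_of_nonneg_right (hC n) ((norm_nonneg _).trans (hB 0)))
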